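/- A partially ordered group is a group $G$ with a partial order such that $a \leq b$ implies $sat \leq sbt$ for all $a,b,s,t \in G$; write $G^+ = \{a \in G : a \geq e\}$. An $\ell$-group is a partially ordered group whose order is a lattice order, an $\ell$-subgroup is a subgroup that is also a sublattice, and a variety of $\ell$-groups is a class of $\ell$-groups defined by equations in the language $(\cdot, {}^{-1}, e, \vee, \wedge)$. A right pre-order on $G$ is identified with its positive cone, i.e. with a proper submonoid $C \subsetneq G$ such that $G = C \cup C^{-1}$ and $G^+ \subseteq C$; the corresponding right-invariant total pre-order is $a \preceq_C b \iff ba^{-1} \in C$. Let $\Omega_C$ be the chain obtained as the quotient of $G$ by the equivalence relation ($a \preceq_C b$ and $b \preceq_C a$), and let $\mathrm{Aut}(\Omega_C)$ be the $\ell$-group of order-preserving bijections of $\Omega_C$, where $f \cdot g$ is "$g$ after $f$" and the order is pointwise. Let $R_C \colon G \to \mathrm{Aut}(\Omega_C)$ be given by $R_C(a)([b]) = [ba]$, and let $H_C$ be the $\ell$-subgroup of $\mathrm{Aut}(\Omega_C)$ generated by $R_C[G]$. For a variety $\mathsf{V}$ of $\ell$-groups, a $\mathsf{V}$-right pre-order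 on $G$ is a right pre-order $C$ with $H_C \in \mathsf{V}$. The set of these carries the smallest topology containing all the sets $\mathbb{P}(a) = \{C : a \in C,\ a^{-1} \notin C\}$, $a \in G$. A topological space $X$ is generalised spectral if it is sober (every nonempty irreducible closed set is the closure of a unique point) and its compact open subsets form a base closed under binary intersections ($X$ itself need not be compact). A generalised spectral space $X$ is completely normal if for all $x, y, z \in X$ with $x, y \in \overline{\{z\}}$, either $x \in \overline{\{y\}}$ or $y \in \overline{\{x\}}$. The specialisation order of $X$ is given by: $x \preceq y$ if and only if $y \in \overline{\{x\}}$. **Corollary.** For every partially ordered group $G$ and every variety $\mathsf{V}$ of $\ell$-groups, the space of $\mathsf{V}$-right pre-orders on $G$ is a completely normal generalised spectral space, and its specialisation order is the inclusion order: for $\mathsf{V}$-right pre-orders $C, D$ on $G$, $D \in \overline{\{C\}}$ if and only if $C \subseteq D$. -/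

import Mathlib

universe u

/-! ### Lattice-ordered groups: terms, equations, varieties, `ℓ`-subgroups

An `ℓ`-group is a type `H` with `[Group H] [Lattice H] [MulLeftMono H] [MulRightMono H]`;
a partially ordered group is the same with `[PartialOrder H]` in place of `[Lattice H]`. -/

/-- Terms in the language `(·, ⁻¹, 1, ⊔, ⊓)` of `ℓ`-groups, over countably many variables. -/
inductive LTerm : Type
  | var (n : ℕ) : LTerm
  | one : LTerm
  | mul (s t : LTerm) : LTerm
  | inv (t : LTerm) : LTerm
  | sup (s t : LTerm) : LTerm
  | inf (s t : LTerm) : LTerm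

/-- The value of a term in `H` under an assignment of elements of `H` to the variables. -/
def LTerm.eval {H : Type u} [Group H] [Lattice H] (x : ℕ → H) : LTerm → H
  | .var n => x n
  | .one => 1
  | .mul s t => s.eval x * t.eval x
  | .inv t => (t.eval x)⁻¹
  | .sup s t => s.eval x ⊔ t.eval x
  | .inf s t => s.eval x ⊓ t.eval x

/-- A variety (equationally definable class) of `ℓ`-groups, given by a set of defining equations
`s ≈ t` (in addition to the axioms of `ℓ`-groups). -/
structure LGroupVariety : Type where
  equations : Set (LTerm × LTerm)

/-- The `ℓ`-group `H` belongs to the variety `V`. -/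
def LGroupVariety.Contains (V : LGroupVariety) (H : Type u) [Group H] [Lattice H]
    [MulLeftMono H] [MulRightMono H] : Prop :=
  ∀ e ∈ V.equations, ∀ x : ℕ → H, e.1.eval x = e.2.eval x

/-- An `ℓ`-subgroup: a subgroup that is also a sublattice. -/
structure LSubgroup (H : Type u) [Group H] [Lattice H] extends Subgroup H where
  sup_mem' : ∀ {a b : H}, a ∈ carrier → b ∈ carrier → a ⊔ b ∈ carrier
  inf_mem' : ∀ {a b : H}, a ∈ carrier → b ∈ carrier → a ⊓ b ∈ carrier

namespace LSubgroup

variable {H : Type u} [Group H] [Lattice H]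

instance : SetLike (LSubgroup H) H where
  coe K := K.carrier
  coe_injective K L h := by
    rcases K with ⟨K, _, _⟩
    rcases L with ⟨L, _, _⟩
    have : K = L := SetLike.coe_injective h
    subst this
    rfl

instance : SubgroupClass (LSubgroup H) H where
  mul_mem {K} _ _ ha hb := K.toSubgroup.mul_mem ha hb
  one_mem K := K.toSubgroup.one_mem
  inv_mem {K} _ ha := K.toSubgroup.inv_mem ha

instance (K : LSubgroup H) : Lattice K :=
  Subtype.lattice (fun _ _ ha hb => K.sup_mem' ha hb) (fun _ _ ha hb => K.inf_mem' ha hb)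

instance (K : LSubgroup H) [MulLeftMono H] : MulLeftMono K :=
  ⟨fun a b c h => mul_le_mul_right (α := H) (b := b.1) (c := c.1) h a.1⟩

instance (K : LSubgroup H) [MulRightMono H] : MulRightMono K :=
  ⟨fun a b c h => mul_le_mul_left (α := H) (b := b.1) (c := c.1) h a.1⟩

/-- The `ℓ`-subgroup generated by `S`: the intersection of all `ℓ`-subgroups containing `S`. -/
def closure (S : Set H) : LSubgroup H where
  carrier := {x | ∀ K : LSubgroup H, S ⊆ (K : Set H) → x ∈ K}
  mul_mem' ha hb K hK := mul_mem (ha K hK) (hb K hK)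
  one_mem' K _ := one_mem K
  inv_mem' ha K hK := inv_mem (ha K hK)
  sup_mem' ha hb K hK := K.sup_mem' (ha K hK) (hb K hK)
  inf_mem' ha hb K hK := K.inf_mem' (ha K hK) (hb K hK)

end LSubgroup

/-! ### The `ℓ`-group of automorphisms of a chain -/

/-- The order-preserving bijections of `Ω`, with `f * g` standing for "`g` after `f`" and
with the pointwise order. -/
def ChainAut (Ω : Type u) [LinearOrder Ω] : Type u := Ω ≃o Ω

namespace ChainAut

variable {Ω : Type u} [LinearOrder Ω]

instance : FunLike (ChainAut Ω) Ω Ω where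
  coe f := (show Ω ≃o Ω from f)
  coe_injective _ _ h := DFunLike.coe_injective (F := Ω ≃o Ω) h

instance : Group (ChainAut Ω) where
  mul f g := OrderIso.trans f g
  one := OrderIso.refl Ω
  inv f := OrderIso.symm f
  mul_assoc _ _ _ := rfl
  one_mul _ := rfl
  mul_one _ := rfl
  inv_mul_cancel f := OrderIso.symm_trans_self f

instance : PartialOrder (ChainAut Ω) :=
  PartialOrder.lift (fun f => (f : Ω → Ω)) DFunLike.coe_injective

theorem monotone_coe (f : ChainAut Ω) : Monotone f := OrderIso.monotone (show Ω ≃o Ω from f)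

theorem apply_inv_apply (f : ChainAut Ω) (x : Ω) : f (f⁻¹ x) = x :=
  OrderIso.apply_symm_apply (show Ω ≃o Ω from f) x

theorem inv_apply_apply (f : ChainAut Ω) (x : Ω) : f⁻¹ (f x) = x :=
  OrderIso.symm_apply_apply (show Ω ≃o Ω from f) x

/-- An automorphism from a pair of mutually inverse monotone maps. -/
def ofMonotone (f g : Ω → Ω) (hf : Monotone f) (hg : Monotone g)
    (hfg : ∀ x, f (g x) = x) (hgf : ∀ x, g (f x) = x) : ChainAut Ω :=
  { toFun := f
    invFun := g
    left_inv := hgf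
    right_inv := hfg
    map_rel_iff' := fun {a b} => ⟨fun h => by simpa [hgf] using hg h, fun h => hf h⟩ :
    Ω ≃o Ω }

instance : Lattice (ChainAut Ω) where
  sup f g := ofMonotone (fun x => f x ⊔ g x) (fun x => f⁻¹ x ⊓ g⁻¹ x)
    (fun _ _ h => sup_le_sup (f.monotone_coe h) (g.monotone_coe h))
    (fun _ _ h => inf_le_inf (f⁻¹.monotone_coe h) (g⁻¹.monotone_coe h))
    (fun x => by
      rcases le_total (f⁻¹ x) (g⁻¹ x) with h | h
      · have := g.monotone_coe h
        rw [apply_inv_apply] at this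
        simpa [inf_eq_left.2 h, apply_inv_apply] using this
      · have := f.monotone_coe h
        rw [apply_inv_apply] at this
        simpa [inf_eq_right.2 h, apply_inv_apply] using this)
    (fun x => by
      rcases le_total (f x) (g x) with h | h
      · have := f⁻¹.monotone_coe h
        rw [inv_apply_apply] at this
        simpa [sup_eq_right.2 h, inv_apply_apply] using this
      · have := g⁻¹.monotone_coe h
        rw [inv_apply_apply] at this
        simpa [sup_eq_left.2 h, inv_apply_apply] using this)
  inf f g := ofMonotone (fun x => f x ⊓ g x) (fun x => f⁻¹ x ⊔ g⁻¹ x)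
    (fun _ _ h => inf_le_inf (f.monotone_coe h) (g.monotone_coe h))
    (fun _ _ h => sup_le_sup (f⁻¹.monotone_coe h) (g⁻¹.monotone_coe h))
    (fun x => by
      rcases le_total (f⁻¹ x) (g⁻¹ x) with h | h
      · have := f.monotone_coe h
        rw [apply_inv_apply] at this
        simpa [sup_eq_right.2 h, apply_inv_apply] using this
      · have := g.monotone_coe h
        rw [apply_inv_apply] at this
        simpa [sup_eq_left.2 h, apply_inv_apply] using this)
    (fun x => by
      rcases le_total (f x) (g x) with h | h
      · have := g⁻¹.monotone_coe h
        rw [inv_apply_apply] at this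
        simpa [inf_eq_left.2 h, inv_apply_apply] using this
      · have := f⁻¹.monotone_coe h
        rw [inv_apply_apply] at this
        simpa [inf_eq_right.2 h, inv_apply_apply] using this)
  le_sup_left f g x := (le_sup_left : f x ≤ f x ⊔ g x)
  le_sup_right f g x := (le_sup_right : g x ≤ f x ⊔ g x)
  sup_le _ _ _ h₁ h₂ x := sup_le (h₁ x) (h₂ x)
  inf_le_left f g x := (inf_le_left : f x ⊓ g x ≤ f x)
  inf_le_right f g x := (inf_le_right : f x ⊓ g x ≤ g x)
  le_inf _ _ _ h₁ h₂ x := le_inf (h₁ x) (h₂ x)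

instance : MulLeftMono (ChainAut Ω) := ⟨fun f _ _ h x => h (f x)⟩

instance : MulRightMono (ChainAut Ω) := ⟨fun f _ _ h x => f.monotone_coe (h x)⟩

end ChainAut

/-! ### Right pre-orders on a partially ordered group -/

/-- A pre-cone of the partially ordered group `G`: a proper submonoid `C` with `G = C ∪ C⁻¹`
that contains the positive cone of `G`. It is identified with the right pre-order
`a ≼ b ↔ b * a⁻¹ ∈ C` on `G` (a right-invariant, total, proper pre-order extending that of `G`). -/
structure PreCone (G : Type u) [Group G] [PartialOrder G] extends Submonoid G where
  mem_of_one_le' : ∀ a : G, 1 ≤ a → a ∈ carrier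
  mem_or_inv_mem' : ∀ a : G, a ∈ carrier ∨ a⁻¹ ∈ carrier
  proper' : carrier ≠ Set.univ

namespace PreCone

variable {G : Type u} [Group G] [PartialOrder G]

instance : SetLike (PreCone G) G where
  coe C := C.carrier
  coe_injective C D h := by
    rcases C with ⟨C, _, _, _⟩
    rcases D with ⟨D, _, _, _⟩
    have : C = D := SetLike.coe_injective h
    subst this
    rfl

/-- The group `G` equipped with the right pre-order given by `C`. -/
def Carrier (_C : PreCone G) : Type u := G

instance (C : PreCone G) : Group C.Carrier := inferInstanceAs (Group G)

instance (C : PreCone G) : Preorder C.Carrier where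
  le a b := (show G from b * a⁻¹) ∈ C
  le_refl a := by
    have h : (1 : G) ∈ C := C.toSubmonoid.one_mem
    rwa [← mul_inv_cancel (show G from a)] at h
  le_trans a b c hab hbc := by
    have h : (show G from c * b⁻¹) * (show G from b * a⁻¹) ∈ C :=
      C.toSubmonoid.mul_mem hbc hab
    have e : (show G from c * b⁻¹) * (show G from b * a⁻¹) = (show G from c * a⁻¹) := by
      change (c * b⁻¹) * (b * a⁻¹) = c * a⁻¹
      group
    rwa [e] at h

theorem carrier_le_iff (C : PreCone G) (a b : C.Carrier) :
    a ≤ b ↔ (show G from b * a⁻¹) ∈ C := Iff.rfl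

theorem mul_le_mul_iff (C : PreCone G) (a b t : C.Carrier) : a * t ≤ b * t ↔ a ≤ b := by
  rw [carrier_le_iff, carrier_le_iff]
  have e : b * t * (a * t)⁻¹ = b * a⁻¹ := by group
  rw [e]

instance (C : PreCone G) : Std.Total (α := C.Carrier) (· ≤ ·) where
  total a b := by
    rcases C.mem_or_inv_mem' (show G from b * a⁻¹) with h | h
    · exact Or.inl h
    · right
      have e : (show G from b * a⁻¹)⁻¹ = (show G from a * b⁻¹) := by
        change (b * a⁻¹)⁻¹ = a * b⁻¹
        group
      rw [e] at h
      exact h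

/-- The chain `Ω_C`: the quotient of `G` by `a ≡ b ↔ a ≼ b ∧ b ≼ a`, with the induced order. -/
def Chain (C : PreCone G) : Type u := Antisymmetrization C.Carrier (· ≤ ·)

open Classical in
noncomputable instance (C : PreCone G) : LinearOrder C.Chain :=
  inferInstanceAs (LinearOrder (Antisymmetrization C.Carrier (· ≤ ·)))

/-- The class `[a]` of `a` in the chain `Ω_C`. -/
def cls (C : PreCone G) (a : G) : C.Chain := toAntisymmetrization (α := C.Carrier) (· ≤ ·) a

/-- The map `[b] ↦ [b * a]` on the chain `Ω_C`. -/
def mulRight (C : PreCone G) (a : G) : C.Chain → C.Chain :=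
  Quotient.map' (s₁ := AntisymmRel.setoid C.Carrier (· ≤ ·))
    (s₂ := AntisymmRel.setoid C.Carrier (· ≤ ·)) (fun b : C.Carrier => b * (show C.Carrier from a))
    (fun x y h => ⟨(C.mul_le_mul_iff x y a).2 h.1, (C.mul_le_mul_iff y x a).2 h.2⟩)

theorem mulRight_cls (C : PreCone G) (a b : G) : C.mulRight a (C.cls b) = C.cls (b * a) := rfl

theorem mulRight_monotone (C : PreCone G) (a : G) : Monotone (C.mulRight a) := by
  intro x y
  induction x using Quotient.inductionOn'
  induction y using Quotient.inductionOn'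
  exact (C.mul_le_mul_iff _ _ a).2

/-- The right regular representation `R_C : G → Aut Ω_C`, `R_C a [b] = [b * a]`. -/
noncomputable def regular (C : PreCone G) (a : G) : ChainAut C.Chain :=
  ChainAut.ofMonotone (C.mulRight a) (C.mulRight a⁻¹) (C.mulRight_monotone a)
    (C.mulRight_monotone a⁻¹)
    (fun x => by
      induction x using Quotient.inductionOn' with | h b => ?_
      exact congrArg C.cls (inv_mul_cancel_right (show G from b) a))
    (fun x => by
      induction x using Quotient.inductionOn' with | h b => ?_
      exact congrArg C.cls (mul_inv_cancel_right (show G from b) a))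

/-- `H_C`: the `ℓ`-subgroup of `Aut Ω_C` generated by the image of `R_C`. -/
noncomputable def lgroup (C : PreCone G) : LSubgroup (ChainAut C.Chain) :=
  LSubgroup.closure (Set.range C.regular)

end PreCone

/-- The set of `V`-right pre-orders on `G`: the right pre-orders `C` such that `H_C ∈ V`. -/
def VRightPreorder (G : Type u) [Group G] [PartialOrder G] (V : LGroupVariety) : Type u :=
  {C : PreCone G // V.Contains C.lgroup}

namespace VRightPreorder

variable {G : Type u} [Group G] [PartialOrder G] {V : LGroupVariety}

instance : SetLike (VRightPreorder G V) G where
  coe C := (C.1 : Set G)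
  coe_injective _ _ h := Subtype.ext (SetLike.coe_injective h)

/-- The set `ℙ(a)` of `V`-right pre-orders in which `a` is strictly positive. -/
def basicOpen (a : G) : Set (VRightPreorder G V) := {C | a ∈ C ∧ a⁻¹ ∉ C}

/-- The smallest topology containing all sets `ℙ(a)`. -/
instance : TopologicalSpace (VRightPreorder G V) :=
  TopologicalSpace.generateFrom (Set.range basicOpen)

end VRightPreorder

/-! ### Generalised spectral spaces -/

/-- A generalised spectral space: sober (`QuasiSober` gives existence and `T0Space` uniqueness
of generic points of irreducible closed sets), with the compact open sets forming a base
closed under binary intersections. No compactness of the whole space is required. -/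
structure IsGeneralisedSpectral (X : Type u) [TopologicalSpace X] : Prop where
  quasiSober : QuasiSober X
  t0Space : T0Space X
  isTopologicalBasis : TopologicalSpace.IsTopologicalBasis {U : Set X | IsOpen U ∧ IsCompact U}
  inter_isCompact : ∀ U W : Set X, IsOpen U → IsCompact U → IsOpen W → IsCompact W →
    IsCompact (U ∩ W)

/-- The specialisation order of a topological space. -/
def SpecialisationLE {X : Type u} [TopologicalSpace X] (x y : X) : Prop := y ∈ closure {x}

/-- A generalised spectral space is completely normal if any two points in the closure
of a point are comparable: one is in the closure of the other. -/
structure IsCompletelyNormalGeneralisedSpectral (X : Type u) [TopologicalSpace X] : Prop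
    extends IsGeneralisedSpectral X where
  completelyNormal : ∀ x y z : X, x ∈ closure {z} → y ∈ closure {z} →
    x ∈ closure {y} ∨ y ∈ closure {x}

/-! Both halves of the argument take limits of ultrafilters.

*Topology.* If every convergent ultrafilter has a limit of which all its other limits are
specialisations, then compact open sets are closed under intersection; and since the points of an
irreducible closed set are exactly the limits of some ultrafilter, that set has a generic point.
For a subbasis `S`, a point lying in exactly those members of `S` which belong to the ultrafilter
is such a limit.

*Algebra.* The pointwise limit `C` of pre-cones `D i` along an ultrafilter is a pre-cone as soon as
it is proper, and `Ω_C` embeds in the ultraproduct of the chains `Ω_{D i}`. So `H_C` is a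
homomorphic image of an `ℓ`-subgroup of the product of the `H_{D i}`, and lies in every variety
containing them. -/

open Filter Topology TopologicalSpace

section GenericLimit

variable {X : Type*} [TopologicalSpace X]

/-- A limit of `l` of which every limit of `l` is a specialisation: the set of limits of `l` is
the closure of `x`. -/
def IsGenericLimit (l : Filter X) (x : X) : Prop :=
  ∀ y, l ≤ 𝓝 y ↔ x ⤳ y

theorem isCompact_inter_of_isGenericLimit
    (h : ∀ (l : Ultrafilter X) (y : X), ↑l ≤ 𝓝 y → ∃ x, IsGenericLimit (l : Filter X) x)
    {U W : Set X} (hU : IsOpen U) (hUc : IsCompact U) (hW : IsOpen W) (hWc : IsCompact W) :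
    IsCompact (U ∩ W) := by
  rw [isCompact_iff_ultrafilter_le_nhds'] at hUc hWc ⊢
  intro l hl
  obtain ⟨y, hyU, hly⟩ := hUc l (mem_of_superset hl Set.inter_subset_left)
  obtain ⟨z, hzW, hlz⟩ := hWc l (mem_of_superset hl Set.inter_subset_right)
  obtain ⟨x, hx⟩ := h l y hly
  exact ⟨x, ⟨((hx y).1 hly).mem_open hU hyU, ((hx z).1 hlz).mem_open hW hzW⟩,
    (hx x).2 specializes_rfl⟩

theorem exists_ultrafilter_le_nhds_iff_mem_of_isIrreducible {Z : Set X} (hirr : IsIrreducible Z)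
    (hZ : IsClosed Z) : ∃ l : Ultrafilter X, ∀ y, ↑l ≤ 𝓝 y ↔ y ∈ Z := by
  classical
  obtain ⟨l, hl⟩ := Ultrafilter.exists_ultrafilter_of_finite_inter_nonempty
    (insert Z {U | IsOpen U ∧ (Z ∩ U).Nonempty}) fun T hT => by
      have hT' : ∀ U ∈ T.erase Z, IsOpen U ∧ (Z ∩ U).Nonempty := fun U hU =>
        (hT (Finset.mem_of_mem_erase hU)).resolve_left (Finset.ne_of_mem_erase hU)
      refine (isIrreducible_iff_sInter.1 hirr (T.erase Z) (fun U hU => (hT' U hU).1)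
        fun U hU => (hT' U hU).2).mono ?_
      rw [← Set.sInter_insert, ← Finset.coe_insert]
      exact Set.sInter_subset_sInter (Finset.coe_subset.2 (Finset.insert_erase_subset Z T))
  have hZl : Z ∈ l := hl (Set.mem_insert _ _)
  refine ⟨l, fun y => ⟨fun hy => isClosed_iff_ultrafilter.1 hZ y l hy hZl, fun hy => ?_⟩⟩
  exact le_nhds_iff.2 fun U hyU hU => hl (Set.mem_insert_of_mem _ ⟨hU, y, hy, hyU⟩)

theorem quasiSober_of_isGenericLimit
    (h : ∀ (l : Ultrafilter X) (y : X), ↑l ≤ 𝓝 y → ∃ x, IsGenericLimit (l : Filter X) x) :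
    QuasiSober X where
  sober {Z} hirr hZ := by
    obtain ⟨l, hl⟩ := exists_ultrafilter_le_nhds_iff_mem_of_isIrreducible hirr hZ
    obtain ⟨y, hy⟩ := hirr.nonempty
    obtain ⟨x, hx⟩ := h l y ((hl y).2 hy)
    exact ⟨x, Set.ext fun z => by rw [← specializes_iff_mem_closure, ← hx z, hl z]⟩

end GenericLimit

section PatchLimit

variable {X : Type u} {S : Set (Set X)} {l : Ultrafilter X} {x : X}

/-- Convergence of `l` to `x` in the patch topology of the subbasis `S`, which is generated by the
members of `S` and their complements. -/
def IsPatchLimit (S : Set (Set X)) (l : Ultrafilter X) (x : X) : Prop :=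
  ∀ U ∈ S, U ∈ l ↔ x ∈ U

variable [t : TopologicalSpace X]

theorem le_nhds_iff_of_generateFrom (hS : t = generateFrom S) {f : Filter X} {y : X} :
    f ≤ 𝓝 y ↔ ∀ U ∈ S, y ∈ U → U ∈ f := by
  subst hS
  exact tendsto_nhds_generateFrom_iff (m := id)

theorem specializes_iff_of_generateFrom (hS : t = generateFrom S) {y : X} :
    x ⤳ y ↔ ∀ U ∈ S, y ∈ U → x ∈ U := by
  rw [specializes_iff_pure, le_nhds_iff_of_generateFrom hS]
  rfl

theorem IsPatchLimit.isGenericLimit (hS : t = generateFrom S) (hx : IsPatchLimit S l x) :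
    IsGenericLimit (l : Filter X) x := fun y => by
  rw [le_nhds_iff_of_generateFrom hS, specializes_iff_of_generateFrom hS]
  exact forall₂_congr fun U hU => imp_congr_right fun _ => hx U hU

theorem isCompact_sInter_of_isPatchLimit (hS : t = generateFrom S)
    (hlim : ∀ l : Ultrafilter X, ∀ U ∈ S, U ∈ l → ∃ x, IsPatchLimit S l x) {T : Set (Set X)}
    (hTS : T ⊆ S) (hT : T.Nonempty) : IsCompact (⋂₀ T) := by
  rw [isCompact_iff_ultrafilter_le_nhds']
  intro l hl
  have hTl : ∀ U ∈ T, U ∈ l := fun U hU => mem_of_superset hl (Set.sInter_subset_of_mem hU)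
  obtain ⟨U, hU⟩ := hT
  obtain ⟨x, hx⟩ := hlim l U (hTS hU) (hTl U hU)
  exact ⟨x, fun W hW => (hx W (hTS hW)).1 (hTl W hW),
    (hx.isGenericLimit hS x).2 specializes_rfl⟩

theorem isTopologicalBasis_isOpen_isCompact_of_isPatchLimit (hS : t = generateFrom S)
    (hcover : ⋃₀ S = Set.univ)
    (hlim : ∀ l : Ultrafilter X, ∀ U ∈ S, U ∈ l → ∃ x, IsPatchLimit S l x) :
    IsTopologicalBasis {U : Set X | IsOpen U ∧ IsCompact U} := by
  refine isTopologicalBasis_of_isOpen_of_nhds (fun U hU => hU.1) fun x U hxU hU => ?_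
  obtain ⟨_, ⟨T, ⟨hTfin, hTS⟩, rfl⟩, hxT, hTU⟩ :=
    (isTopologicalBasis_of_subbasis hS).exists_subset_of_mem_open hxU hU
  -- `T` may be empty, and `X` is not assumed to be compact.
  obtain ⟨W, hWS, hxW⟩ := Set.sUnion_eq_univ_iff.1 hcover x
  have hWTS : insert W T ⊆ S := Set.insert_subset hWS hTS
  have hopen : ∀ U ∈ insert W T, IsOpen U := fun U hU => hS ▸ isOpen_generateFrom_of_mem (hWTS hU)
  refine ⟨⋂₀ insert W T, ⟨(hTfin.insert W).isOpen_sInter hopen,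
    isCompact_sInter_of_isPatchLimit hS hlim hWTS (Set.insert_nonempty W T)⟩, ?_, ?_⟩
  · exact Set.sInter_insert W T ▸ ⟨hxW, hxT⟩
  · exact (Set.sInter_subset_sInter (Set.subset_insert W T)).trans hTU

theorem isGeneralisedSpectral_of_isPatchLimit [T0Space X] (hS : t = generateFrom S)
    (hcover : ⋃₀ S = Set.univ)
    (hlim : ∀ l : Ultrafilter X, ∀ U ∈ S, U ∈ l → ∃ x, IsPatchLimit S l x) :
    IsGeneralisedSpectral X := by
  have hgen (l : Ultrafilter X) (y : X) (hy : ↑l ≤ 𝓝 y) : ∃ x, IsGenericLimit (l : Filter X) x := by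
    obtain ⟨U, hU, hyU⟩ := Set.sUnion_eq_univ_iff.1 hcover y
    obtain ⟨x, hx⟩ := hlim l U hU ((le_nhds_iff_of_generateFrom hS).1 hy U hU hyU)
    exact ⟨x, hx.isGenericLimit hS⟩
  exact
    { quasiSober := quasiSober_of_isGenericLimit hgen
      t0Space := inferInstance
      isTopologicalBasis := isTopologicalBasis_isOpen_isCompact_of_isPatchLimit hS hcover hlim
      inter_isCompact := fun _ _ => isCompact_inter_of_isGenericLimit hgen }

end PatchLimit

section Variety

theorem LTerm.map_eval {H K : Type*} [Group H] [Lattice H] [Group K] [Lattice K] (f : H →* K)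
    (hsup : ∀ a b, f (a ⊔ b) = f a ⊔ f b) (hinf : ∀ a b, f (a ⊓ b) = f a ⊓ f b) (x : ℕ → H)
    (t : LTerm) : f (t.eval x) = t.eval fun n => f (x n) := by
  induction t with
  | var n => rfl
  | one => exact map_one f
  | mul s t hs ht => exact (map_mul f _ _).trans (congrArg₂ (· * ·) hs ht)
  | inv t ht => exact (map_inv f _).trans (congrArg (·⁻¹) ht)
  | sup s t hs ht => exact (hsup _ _).trans (congrArg₂ (· ⊔ ·) hs ht)
  | inf s t hs ht => exact (hinf _ _).trans (congrArg₂ (· ⊓ ·) hs ht)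

theorem LSubgroup.coe_eval {H : Type*} [Group H] [Lattice H] (K : LSubgroup H) (x : ℕ → K)
    (t : LTerm) : ((t.eval x : K) : H) = t.eval fun n => (x n : H) :=
  t.map_eval (SubgroupClass.subtype K) (fun _ _ => rfl) (fun _ _ => rfl) x

instance {ι : Type*} {H : ι → Type*} [∀ i, Mul (H i)] [∀ i, Preorder (H i)]
    [∀ i, MulLeftMono (H i)] : MulLeftMono (∀ i, H i) :=
  ⟨fun a _ _ h i => mul_le_mul_right (h i) (a i)⟩

instance {ι : Type*} {H : ι → Type*} [∀ i, Mul (H i)] [∀ i, Preorder (H i)]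
    [∀ i, MulRightMono (H i)] : MulRightMono (∀ i, H i) :=
  ⟨fun a _ _ h i => mul_le_mul_left (h i) (a i)⟩

theorem LGroupVariety.Contains.pi {V : LGroupVariety} {ι : Type*} {H : ι → Type*}
    [∀ i, Group (H i)] [∀ i, Lattice (H i)] [∀ i, MulLeftMono (H i)] [∀ i, MulRightMono (H i)]
    (hV : ∀ i, V.Contains (H i)) : V.Contains (∀ i, H i) := fun e he x => by
  have eval_apply (t : LTerm) (i : ι) : t.eval x i = t.eval fun n => x n i :=
    t.map_eval (Pi.evalMonoidHom H i) (fun _ _ => rfl) (fun _ _ => rfl) x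
  funext i
  rw [eval_apply, eval_apply, hV i e he]

variable {A B : Type*} [Group A] [Lattice A] [Group B] [Lattice B]

/-- The elements of `B` related to some element of `A` by an `ℓ`-subgroup `R` of `A × B`, thought
of as a relation compatible with the `ℓ`-group operations. -/
def LSubgroup.codomain (R : LSubgroup (A × B)) : LSubgroup B where
  carrier := {b | ∃ a, (a, b) ∈ R}
  mul_mem' := fun ⟨_, h⟩ ⟨_, h'⟩ => ⟨_, mul_mem h h'⟩
  one_mem' := ⟨1, one_mem R⟩
  inv_mem' := fun ⟨_, h⟩ => ⟨_, inv_mem h⟩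
  sup_mem' := fun ⟨_, h⟩ ⟨_, h'⟩ => ⟨_, R.sup_mem' h h'⟩
  inf_mem' := fun ⟨_, h⟩ ⟨_, h'⟩ => ⟨_, R.inf_mem' h h'⟩

theorem LSubgroup.eval_mk_mem (R : LSubgroup (A × B)) {a : ℕ → A} {b : ℕ → B}
    (hab : ∀ n, (a n, b n) ∈ R) (t : LTerm) : (t.eval a, t.eval b) ∈ R := by
  have hfst := t.map_eval (MonoidHom.fst A B) (fun _ _ => rfl) (fun _ _ => rfl)
    fun n => (a n, b n)
  have hsnd := t.map_eval (MonoidHom.snd A B) (fun _ _ => rfl) (fun _ _ => rfl)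
    fun n => (a n, b n)
  have hmem := (t.eval fun n => (⟨(a n, b n), hab n⟩ : R)).2
  rw [R.coe_eval] at hmem
  convert hmem using 1
  exact Prod.ext hfst.symm hsnd.symm

-- `R` makes the generated `ℓ`-subgroup a homomorphic image of an `ℓ`-subgroup of `A`.
theorem LGroupVariety.Contains.closure_of_functional {V : LGroupVariety} [MulLeftMono A]
    [MulRightMono A] [MulLeftMono B] [MulRightMono B] (hA : V.Contains A) (R : LSubgroup (A × B))
    (hR : ∀ {a b b'}, (a, b) ∈ R → (a, b') ∈ R → b = b') {S : Set B}
    (hS : S ⊆ (R.codomain : Set B)) : V.Contains (LSubgroup.closure S) := by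
  intro e he x
  choose a ha using fun n => (x n).2 R.codomain hS
  apply Subtype.ext
  rw [LSubgroup.coe_eval, LSubgroup.coe_eval]
  exact hR (R.eval_mk_mem ha e.1) (hA e he a ▸ R.eval_mk_mem ha e.2)

end Variety

theorem le_total_of_forall_mem_or_inv_mem {G : Type*} [Group G] {C : Set G} {D E : Submonoid G}
    (hC : ∀ a, a ∈ C ∨ a⁻¹ ∈ C) (hD : C ⊆ D) (hE : C ⊆ E) : D ≤ E ∨ E ≤ D := by
  by_contra! h
  obtain ⟨⟨d, hdD, hdE⟩, ⟨e, heE, heD⟩⟩ := h.imp SetLike.not_le_iff_exists.1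
    SetLike.not_le_iff_exists.1
  rcases hC (d * e⁻¹) with hde | hde
  · exact hdE (by simpa using E.mul_mem (hE hde) heE)
  · exact heD (by simpa using D.mul_mem (hD hde) hdD)

namespace PreCone

variable {G : Type u} [Group G] [PartialOrder G]

theorem cls_surjective (C : PreCone G) : Function.Surjective C.cls :=
  Quotient.mk_surjective

section Ultralimit

variable {ι : Type u} {l : Ultrafilter ι} {D : ι → PreCone G} {C : PreCone G}

/-- `C` is the pointwise limit of the `D i` along `l`, that is, their limit in the product
topology on the subsets of `G`. -/
def IsUltralimit (l : Ultrafilter ι) (D : ι → PreCone G) (C : PreCone G) : Prop :=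
  ∀ a, a ∈ C ↔ ∀ᶠ i in l, a ∈ D i

theorem exists_isUltralimit {a : G} (ha : ∀ᶠ i in l, a ∉ D i) : ∃ C, IsUltralimit l D C :=
  ⟨{carrier := {b | ∀ᶠ i in l, b ∈ D i}
    mul_mem' := fun hb hc => by
      filter_upwards [hb, hc] with i hbi hci using (D i).mul_mem hbi hci
    one_mem' := Eventually.of_forall fun i => (D i).one_mem
    mem_of_one_le' := fun b hb => Eventually.of_forall fun i => (D i).mem_of_one_le' b hb
    mem_or_inv_mem' := fun b =>
      Ultrafilter.eventually_or.1 (Eventually.of_forall fun i => (D i).mem_or_inv_mem' b)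
    proper' := fun h => Ultrafilter.eventually_not.1 ha (h.ge (Set.mem_univ a)) }, fun _ => Iff.rfl⟩

theorem IsUltralimit.cls_le_cls_iff (hC : IsUltralimit l D C) {a b : G} :
    C.cls a ≤ C.cls b ↔ ∀ᶠ i in l, (D i).cls a ≤ (D i).cls b :=
  hC (b * a⁻¹)

theorem IsUltralimit.cls_eq_cls_iff (hC : IsUltralimit l D C) {a b : G} :
    C.cls a = C.cls b ↔ ∀ᶠ i in l, (D i).cls a = (D i).cls b := by
  simp only [le_antisymm_iff, hC.cls_le_cls_iff, eventually_and]

/-- The automorphisms `f i` of the chains `Ω_{D i}` induce `h` on `Ω_C`, the class of `b` in `Ω_C`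
being thought of as the class modulo `l` of the family of classes of `b` in `Ω_{D i}`. -/
def Induces (l : Ultrafilter ι) (f : ∀ i, ChainAut (D i).Chain) (h : ChainAut C.Chain) : Prop :=
  ∀ b c, h (C.cls b) = C.cls c → ∀ᶠ i in l, f i ((D i).cls b) = (D i).cls c

namespace Induces

variable {f f' : ∀ i, ChainAut (D i).Chain} {h h' : ChainAut C.Chain}

theorem eq (hC : IsUltralimit l D C) (hf : Induces l f h) (hf' : Induces l f h') : h = h' := by
  refine DFunLike.ext _ _ fun x => ?_
  obtain ⟨b, rfl⟩ := C.cls_surjective x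
  obtain ⟨c, hc⟩ := C.cls_surjective (h (C.cls b))
  obtain ⟨c', hc'⟩ := C.cls_surjective (h' (C.cls b))
  rw [← hc, ← hc', hC.cls_eq_cls_iff]
  filter_upwards [hf b c hc.symm, hf' b c' hc'.symm] with i hi hi'
  exact hi.symm.trans hi'

theorem regular (hC : IsUltralimit l D C) (a : G) :
    Induces l (fun i => (D i).regular a) (C.regular a) :=
  fun _ _ hbc => hC.cls_eq_cls_iff.1 hbc

theorem one (hC : IsUltralimit l D C) :
    Induces l (fun i => (1 : ChainAut (D i).Chain)) (1 : ChainAut C.Chain) :=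
  fun _ _ hbc => hC.cls_eq_cls_iff.1 hbc

theorem inv (hf : Induces l f h) : Induces l (fun i => (f i)⁻¹) h⁻¹ := fun b c hbc => by
  have hcb : h (C.cls c) = C.cls b := by rw [← hbc, h.apply_inv_apply]
  filter_upwards [hf c b hcb] with i hi
  rw [← hi, (f i).inv_apply_apply]

theorem mul (hf : Induces l f h) (hf' : Induces l f' h') :
    Induces l (fun i => f i * f' i) (h * h') := fun b c hbc => by
  obtain ⟨d, hd⟩ := C.cls_surjective (h (C.cls b))
  have hdc : h' (C.cls d) = C.cls c := hd ▸ hbc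
  filter_upwards [hf b d hd.symm, hf' d c hdc] with i hi hi'
  change f' i (f i _) = _
  rw [hi, hi']

theorem sup (hC : IsUltralimit l D C) (hf : Induces l f h) (hf' : Induces l f' h') :
    Induces l (fun i => f i ⊔ f' i) (h ⊔ h') := fun b c hbc => by
  obtain ⟨d, hd⟩ := C.cls_surjective (h (C.cls b))
  obtain ⟨d', hd'⟩ := C.cls_surjective (h' (C.cls b))
  change h (C.cls b) ⊔ h' (C.cls b) = C.cls c at hbc
  rw [← hd, ← hd'] at hbc
  have hsup : ∀ᶠ i in l, (D i).cls d ⊔ (D i).cls d' = (D i).cls c := by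
    rcases le_total (C.cls d) (C.cls d') with hle | hle
    · rw [sup_eq_right.2 hle] at hbc
      filter_upwards [hC.cls_le_cls_iff.1 hle, hC.cls_eq_cls_iff.1 hbc] with i hi hi'
      rw [sup_eq_right.2 hi, hi']
    · rw [sup_eq_left.2 hle] at hbc
      filter_upwards [hC.cls_le_cls_iff.1 hle, hC.cls_eq_cls_iff.1 hbc] with i hi hi'
      rw [sup_eq_left.2 hi, hi']
  filter_upwards [hf b d hd.symm, hf' b d' hd'.symm, hsup] with i hi hi' hsup
  change f i _ ⊔ f' i _ = _
  rw [hi, hi', hsup]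

theorem inf (hC : IsUltralimit l D C) (hf : Induces l f h) (hf' : Induces l f' h') :
    Induces l (fun i => f i ⊓ f' i) (h ⊓ h') := by
  simpa only [inv_sup, inv_inv] using (hf.inv.sup hC hf'.inv).inv

end Induces

/-- The relation `Induces` between the product of the `H_{D i}` and `Aut Ω_C`, as an
`ℓ`-subgroup. -/
def inducesLSubgroup (hC : IsUltralimit l D C) :
    LSubgroup ((∀ i, (D i).lgroup) × ChainAut C.Chain) where
  carrier := {p | Induces l (fun i => (p.1 i : ChainAut (D i).Chain)) p.2}
  mul_mem' := Induces.mul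
  one_mem' := Induces.one hC
  inv_mem' := Induces.inv
  sup_mem' := Induces.sup hC
  inf_mem' := Induces.inf hC

theorem IsUltralimit.contains_lgroup {V : LGroupVariety} (hC : IsUltralimit l D C)
    (hD : ∀ i, V.Contains (D i).lgroup) : V.Contains C.lgroup := by
  refine (LGroupVariety.Contains.pi hD).closure_of_functional (inducesLSubgroup hC)
    (fun hf hf' => Induces.eq hC hf hf') ?_
  rintro _ ⟨a, rfl⟩
  exact ⟨fun i => ⟨(D i).regular a, fun _ hK => hK ⟨a, rfl⟩⟩, Induces.regular hC a⟩

end Ultralimit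

end PreCone

namespace VRightPreorder

variable {G : Type u} [Group G] [PartialOrder G] {V : LGroupVariety}

theorem mem_basicOpen_iff {a : G} {C : VRightPreorder G V} : C ∈ basicOpen a ↔ a⁻¹ ∉ C :=
  ⟨fun h => h.2, fun h => ⟨(C.1.mem_or_inv_mem' a).resolve_right h, h⟩⟩

theorem specializes_iff_subset {C D : VRightPreorder G V} : C ⤳ D ↔ (C : Set G) ⊆ D := by
  rw [specializes_iff_of_generateFrom rfl, Set.forall_mem_range]
  simp only [mem_basicOpen_iff, not_imp_not]
  exact (inv_surjective.forall (p := fun a => a ∈ C → a ∈ D)).symm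

theorem mem_closure_singleton_iff_subset {C D : VRightPreorder G V} :
    D ∈ closure {C} ↔ (C : Set G) ⊆ D := by
  rw [← specializes_iff_mem_closure, specializes_iff_subset]

instance : T0Space (VRightPreorder G V) :=
  ⟨fun _ _ h => SetLike.coe_injective
    ((specializes_iff_subset.1 h.specializes).antisymm (specializes_iff_subset.1 h.specializes'))⟩

theorem sUnion_range_basicOpen :
    ⋃₀ Set.range (basicOpen : G → Set (VRightPreorder G V)) = Set.univ := by
  refine Set.sUnion_eq_univ_iff.2 fun C => ?_
  obtain ⟨a, ha⟩ := (Set.ne_univ_iff_exists_notMem _).1 C.1.proper'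
  exact ⟨basicOpen a⁻¹, ⟨a⁻¹, rfl⟩, mem_basicOpen_iff.2 (by rwa [inv_inv])⟩

theorem exists_isPatchLimit {l : Ultrafilter (VRightPreorder G V)} {a : G} (ha : basicOpen a ∈ l) :
    ∃ C, IsPatchLimit (Set.range basicOpen) l C := by
  have ha' : ∀ᶠ D : VRightPreorder G V in l, a⁻¹ ∉ D.1 :=
    mem_of_superset ha fun _ => mem_basicOpen_iff.1
  obtain ⟨C, hC⟩ : ∃ C, PreCone.IsUltralimit l (fun D : VRightPreorder G V => D.1) C :=
    PreCone.exists_isUltralimit ha'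
  have hCV : V.Contains C.lgroup := hC.contains_lgroup fun D => D.2
  refine ⟨⟨C, hCV⟩, Set.forall_mem_range.2 fun b => ?_⟩
  calc basicOpen b ∈ l ↔ ∀ᶠ D : VRightPreorder G V in l, b⁻¹ ∉ D.1 :=
        eventually_congr (Eventually.of_forall fun _ => mem_basicOpen_iff)
    _ ↔ b⁻¹ ∉ C := by rw [hC, Ultrafilter.eventually_not]
    _ ↔ ⟨C, hCV⟩ ∈ basicOpen b := (mem_basicOpen_iff (C := ⟨C, hCV⟩)).symm

theorem isGeneralisedSpectral : IsGeneralisedSpectral (VRightPreorder G V) :=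
  isGeneralisedSpectral_of_isPatchLimit rfl sUnion_range_basicOpen fun _ =>
    Set.forall_mem_range.2 fun _ => exists_isPatchLimit

theorem subset_or_subset_of_subset {C D E : VRightPreorder G V} (hD : (C : Set G) ⊆ D)
    (hE : (C : Set G) ⊆ E) : (D : Set G) ⊆ E ∨ (E : Set G) ⊆ D :=
  le_total_of_forall_mem_or_inv_mem (D := D.1.toSubmonoid) (E := E.1.toSubmonoid)
    C.1.mem_or_inv_mem' hD hE

end VRightPreorder

open VRightPreorder in
theorem corollary2p6_general (G : Type u) [Group G] [PartialOrder G] (V : LGroupVariety) :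
    IsCompletelyNormalGeneralisedSpectral (VRightPreorder G V) ∧
      ∀ C D : VRightPreorder G V, SpecialisationLE C D ↔ (C : Set G) ⊆ (D : Set G) := by
  refine ⟨{ isGeneralisedSpectral with completelyNormal := fun C D E hC hD => ?_ },
    fun _ _ => mem_closure_singleton_iff_subset⟩
  simp only [mem_closure_singleton_iff_subset] at hC hD ⊢
  exact subset_or_subset_of_subset hD hC

theorem corollary2p6 (G : Type u) [Group G] [PartialOrder G] [MulLeftMono G] [MulRightMono G]
    (V : LGroupVariety) :
    IsCompletelyNormalGeneralisedSpectral (VRightPreorder G V) ∧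
      ∀ C D : VRightPreorder G V, SpecialisationLE C D ↔ (C : Set G) ⊆ (D : Set G) :=
  corollary2p6_general G V
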